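/- For an integer $k\ge 2$ and real numbers $\beta_1\ge\dots\ge\beta_k\ge 0$, put $\alpha_i=\sqrt{2\beta_i+1}$ and $$G(\xi_1,\dots,\xi_k)=\frac1k\sum_{i=1}^k\sqrt{\alpha_i^2+\xi_i^2},\qquad T=\Bigl\{\xi\in\mathbb R^k:\ \xi_i\in[-\beta_i,\beta_i]\ (1\le i\le k),\ \sum_{i=1}^k\xi_i=0\Bigr\}.$$ A variable $\xi_i$ is called filled if $\xi_i\in\{\beta_i,-\beta_i\}$. (The same definitions are used in (a) below for every $k\ge0$ and without an ordering of the $\beta_i$.) The problem AMCCR is: given $k\ge2$ and rational numbers $\beta_1\ge\dots\ge\beta_k\ge0$ (written as binary fractions in lowest terms, $k$ being part of the input), find disjoint sets $J_+,J_-\subseteq\{1,\dots,k\}$ with $|J_+|+|J_-|=k-1$ for which there is a maximizer $\xi^*$ of $G$ over $T$ such that $\xi^*_i=\beta_i$ for $i\in J_+$, $\xi^*_i=-\beta_i$ for $i\in J_-$, and, for the remaining index $h$, $\xi^*_h=\sum_{i\in J_-}\beta_i-\sum_{i\in J_+}\beta_i\in[-\beta_h,\beta_h]$. The problem PARTITION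 is: given positive integers $a_1,\dots,a_k$ (in binary, in any order, repetitions allowed), decide whether there is $J\subseteq\{1,\dots,k\}$ with $\sum_{i\in J}a_i=\sum_{i\notin J}a_i$. Theorem. (a) Let $a_1,\dots,a_k$ be positive integers, put $\beta_i=a_i$, and let $\xi^*$ be any maximizer of $G$ over $T$. Then every variable of $\xi^*$ is filled if and only if there is $J\subseteq\{1,\dots,k\}$ with $\sum_{i\in J}a_i=\sum_{i\notin J}a_i$. (b) If there is a polynomial-time algorithm (Turing machine) for AMCCR, then there is a polynomial-time algorithm for PARTITION. In this sense, AMCCR for general $k$ is NP-hard. -/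

import Mathlib

open scoped BigOperators

namespace AMCCR

/-- `α = √r`, where `2 β = r - 1`, i.e. `α² = 2 β + 1`. -/
noncomputable def alpha (b : ℝ) : ℝ := Real.sqrt (2 * b + 1)

/-- The objective `G(ξ) = (1/k) ∑ √(α_i² + ξ_i²)`. -/
noncomputable def G {k : ℕ} (β ξ : Fin k → ℝ) : ℝ :=
  (1 / (k : ℝ)) * ∑ i, Real.sqrt (alpha (β i) ^ 2 + ξ i ^ 2)

/-- The feasible set: `ξ_i ∈ [-β_i, β_i]` for all `i`, and `∑ ξ_i = 0`. -/
def feasible {k : ℕ} (β : Fin k → ℝ) : Set (Fin k → ℝ) :=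
  {ξ | (∀ i, ξ i ∈ Set.Icc (-β i) (β i)) ∧ ∑ i, ξ i = 0}

/-- `ξ` is a maximizer of `G` over the feasible set. -/
def IsMaximizer {k : ℕ} (β ξ : Fin k → ℝ) : Prop :=
  ξ ∈ feasible β ∧ IsMaxOn (G β) (feasible β) ξ

/-- The variable `ξ_i` is filled if it lies at an end point of `[-β_i, β_i]`. -/
def Filled {k : ℕ} (β ξ : Fin k → ℝ) (i : Fin k) : Prop :=
  ξ i = β i ∨ ξ i = -β i

/-- The index sets `J₊, J₋` describe some maximizer of `G`: they are disjoint and miss exactly one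
index `h`; the maximizer is `β_i` on `J₊`, `-β_i` on `J₋`, and its value at `h` is
`∑_{J₋} β_i - ∑_{J₊} β_i`, which lies in `[-β_h, β_h]`. -/
def IsSolution {k : ℕ} (β : Fin k → ℝ) (Jp Jm : Finset (Fin k)) : Prop :=
  ∃ ξ : Fin k → ℝ, IsMaximizer β ξ ∧
    Disjoint Jp Jm ∧ Jp.card + Jm.card + 1 = k ∧
    (∀ i ∈ Jp, ξ i = β i) ∧
    (∀ i ∈ Jm, ξ i = -β i) ∧
    ∀ h : Fin k, h ∉ Jp → h ∉ Jm →
      ∑ i ∈ Jm, β i - ∑ i ∈ Jp, β i = ξ h ∧ ξ h ∈ Set.Icc (-β h) (β h)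

/-- An instance of the problem AMCCR: rational numbers `β_1 ≥ ⋯ ≥ β_k ≥ 0` with `k ≥ 2`.
The number `k` is part of the input. -/
structure Instance where
  k : ℕ
  two_le : 2 ≤ k
  β : Fin k → ℚ≥0
  antitone : Antitone β

/-- An instance of PARTITION: a finite list of positive integers (in any order, with repetitions
allowed). -/
structure PartitionInstance where
  k : ℕ
  a : Fin k → ℕ+

/-- The instance is positive: the index set splits into two parts of equal sum. -/
def PartitionInstance.IsPositive (A : PartitionInstance) : Prop :=
  ∃ J : Finset (Fin A.k), ∑ i ∈ J, (A.a i : ℕ) = ∑ i ∈ Jᶜ, (A.a i : ℕ)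

/-- The input alphabet: two binary digits, a fraction bar, and an end marker for each number. -/
inductive Symbol where
  | bit (b : Bool)
  | slash
  | comma
  deriving DecidableEq, Fintype

/-- Binary notation, least significant digit first, without leading zeros. -/
def encodeNatural (n : ℕ) : List Symbol := n.bits.map Symbol.bit

/-- Each `β_i` is written as a fraction in lowest terms, numerator and denominator in binary. -/
def Instance.encode (I : Instance) : List Symbol :=
  (List.ofFn I.β).flatMap fun q =>
    encodeNatural q.num ++ [Symbol.slash] ++ encodeNatural q.den ++ [Symbol.comma]

/-- Each `a_i` is written in binary. -/
def PartitionInstance.encode (A : PartitionInstance) : List Symbol :=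
  (List.ofFn A.a).flatMap fun n => encodeNatural (n : ℕ) ++ [Symbol.comma]

/-- A pair of subsets of the index set, written as the word of length `k` whose `i`th letter records
the membership of `i` in the two sets. -/
def encodePair {k : ℕ} (Jp Jm : Finset (Fin k)) : List (Bool × Bool) :=
  List.ofFn fun i => (decide (i ∈ Jp), decide (i ∈ Jm))

/-- There is a polynomial-time algorithm for AMCCR: a Turing machine that, on every instance, writes
within polynomial time in the length of the input a pair `J₊, J₋` solving that instance. -/
def PolyTimeSolvable : Prop :=
  ∃ alg : Instance → List (Bool × Bool),
    Nonempty (Turing.TM2ComputableInPolyTime Instance.encode id alg) ∧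
    ∀ I : Instance, ∃ Jp Jm : Finset (Fin I.k),
      alg I = encodePair Jp Jm ∧ IsSolution (fun i => (I.β i : ℝ)) Jp Jm

/-- There is a polynomial-time algorithm for PARTITION: a Turing machine that decides, within
polynomial time in the length of the input, whether the instance is positive. -/
def PartitionPolyTimeDecidable : Prop :=
  ∃ alg : PartitionInstance → Bool,
    Nonempty (Turing.TM2ComputableInPolyTime PartitionInstance.encode
      Computability.encodeBool alg) ∧
    ∀ A : PartitionInstance, alg A = true ↔ A.IsPositive

end AMCCR

/-! Since `alpha b ^ 2 = 2 * b + 1`, the identity (2b + 1) + b² = (b + 1)² bounds each summand of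
`G` by β_i + 1, with equality exactly at the two end points. A completely filled feasible point
therefore attains an upper bound for `G`, and every maximizer must then be filled as well
(`IsMaximizer.filled`). Such a point is a vanishing sum of the β_i with signs, that is, a partition;
this gives `filled_iff_isPositive`.

For the complexity statement a solver of AMCCR is called once. It wants a nonincreasing list, and
its answer leaves one sign open. The list `padded` settles both points: each a becomes a pair 2^p +
a, 2^p, and the exponents fall so fast along the list that it is sorted by construction. In a
vanishing sign sum the large parts of a pair have to cancel, so the two signs are opposite, the pair
contributes ±a, and an open sign can be read off its partner (`signedSum_eq`). Conversely, whatever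
the codes are, `signedSum` is a sign sum of the original numbers. Hence `signedSum_eq_zero_iff`.

The rest realizes this on a stack machine. Padding needs no arithmetic: it inserts zeros and a
leading one (`bits_two_pow_add`), and the number of zeros comes from counting input symbols
(`length_listCode`). The final sum is kept in digits -1, 0, 1, so that it vanishes only if all
digits do. `machine` wraps these phases around a copy of the solver, and `runsIn_machine` adds up
the times. -/

namespace AMCCR

/-! ### The upper bound for the objective and its equality case. -/

section Filled

/-- The choice of `alpha` makes the radicand at x = ±b the perfect square (b + 1)², and x² ≤ b² on
the interval. -/
theorem sqrt_alpha_sq_add_sq_le {b x : ℝ} (hb : 0 ≤ b) (hx : x ∈ Set.Icc (-b) b) :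
    Real.sqrt (alpha b ^ 2 + x ^ 2) ≤ b + 1 := by
  rw [alpha, Real.sq_sqrt (by linarith)]
  apply Real.sqrt_le_iff.2 ⟨by linarith, _⟩
  nlinarith [hx.1, hx.2]

theorem sqrt_alpha_sq_add_sq_eq_iff {b x : ℝ} (hb : 0 ≤ b) :
    Real.sqrt (alpha b ^ 2 + x ^ 2) = b + 1 ↔ x = b ∨ x = -b := by
  rw [alpha, Real.sq_sqrt (by linarith), Real.sqrt_eq_iff_mul_self_eq (by positivity) (by linarith),
    ← sq_eq_sq_iff_eq_or_eq_neg]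
  constructor <;> intro h <;> nlinarith

/-- If some feasible point is completely filled, then so is every maximizer. -/
theorem IsMaximizer.filled {k : ℕ} {β ξ η : Fin k → ℝ} (hβ : ∀ i, 0 ≤ β i)
    (hξ : IsMaximizer β ξ) (hη : η ∈ feasible β) (hfill : ∀ i, Filled β η i) (i : Fin k) :
    Filled β ξ i := by
  have hk : (0 : ℝ) < 1 / (k : ℝ) := by
    have : 0 < k := i.pos
    positivity
  have hle : ∀ j ∈ Finset.univ, Real.sqrt (alpha (β j) ^ 2 + ξ j ^ 2) ≤ β j + 1 := fun j _ =>
    sqrt_alpha_sq_add_sq_le (hβ j) (hξ.1.1 j)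
  have hG : G β η ≤ G β ξ := hξ.2 hη
  have hsum : ∑ j, Real.sqrt (alpha (β j) ^ 2 + η j ^ 2) = ∑ j, (β j + 1) :=
    Finset.sum_congr rfl fun j _ => (sqrt_alpha_sq_add_sq_eq_iff (hβ j)).2 (hfill j)
  have hge := le_of_mul_le_mul_left hG hk
  rw [hsum] at hge
  -- A sum of termwise upper bounds is attained only if each of them is.
  have heq := (Finset.sum_eq_sum_iff_of_le hle).1 (le_antisymm (Finset.sum_le_sum hle) hge)
  exact (sqrt_alpha_sq_add_sq_eq_iff (hβ i)).1 (heq i (Finset.mem_univ i))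

end Filled

/-! ### Sign sums, partitions and solutions of AMCCR. -/

section SignSums

/-- The integer `x` is a sum of the members of the list with signs. -/
def Attains : List ℕ → ℤ → Prop
  | [], x => x = 0
  | a :: l, x => Attains l (x - a) ∨ Attains l (x + a)

/-- Needed because the machine, writing onto a stack, reverses the order of the numbers. -/
theorem Attains.perm {l m : List ℕ} (h : l.Perm m) : ∀ {x : ℤ}, Attains l x → Attains m x := by
  induction h with
  | nil => exact id
  | cons a _ ih => exact fun hx => hx.imp ih ih
  | swap a b l =>
    intro x hx
    simp only [Attains] at hx ⊢
    rw [show x - a - b = x - b - a by ring, show x - a + b = x + b - a by ring,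
      show x + a - b = x - b + a by ring, show x + a + b = x + b + a by ring]
    tauto
  | trans _ _ ih₁ ih₂ => exact fun hx => ih₂ (ih₁ hx)

theorem attains_ofFn {k : ℕ} (f : Fin k → ℕ) (x : ℤ) :
    Attains (List.ofFn f) x ↔
      ∃ s : Fin k → ℤ, (∀ i, s i = 1 ∨ s i = -1) ∧ ∑ i, s i * (f i : ℤ) = x := by
  induction k generalizing x with
  | zero => simp [Attains, eq_comm]
  | succ k ih =>
    rw [List.ofFn_succ, Attains, ih, ih]
    constructor
    · rintro (⟨s, hs, h⟩ | ⟨s, hs, h⟩)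
      · refine ⟨Fin.cons 1 s, Fin.cases (by simp) (by simpa using hs), ?_⟩
        simp [Fin.sum_univ_succ, h]
      · refine ⟨Fin.cons (-1) s, Fin.cases (by simp) (by simpa using hs), ?_⟩
        simp [Fin.sum_univ_succ, h]
    · rintro ⟨s, hs, h⟩
      rw [Fin.sum_univ_succ] at h
      rcases hs 0 with h0 | h0
      · exact Or.inl ⟨fun i => s i.succ, fun i => hs _, by rw [h0] at h; linarith⟩
      · exact Or.inr ⟨fun i => s i.succ, fun i => hs _, by rw [h0] at h; linarith⟩

/-- The integer `x` is a sum of the members of the list with signs that agree with the codes. -/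
def AttainsWith : List ℕ → List (Bool × Bool) → ℤ → Prop
  | [], _, x => x = 0
  | _ :: _, [], _ => False
  | a :: l, c :: cs, x => ∃ s : ℤ, (s = 1 ∨ s = -1) ∧ (c.1 = true → s = 1) ∧ (c.2 = true → s = -1) ∧
      AttainsWith l cs (x - s * a)

theorem attainsWith_ofFn {k : ℕ} (f : Fin k → ℕ) (c : Fin k → Bool × Bool) (s : Fin k → ℤ)
    (hs : ∀ i, s i = 1 ∨ s i = -1) (h₁ : ∀ i, (c i).1 = true → s i = 1)
    (h₂ : ∀ i, (c i).2 = true → s i = -1) :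
    AttainsWith (List.ofFn f) (List.ofFn c) (∑ i, s i * (f i : ℤ)) := by
  induction k with
  | zero => simp [AttainsWith]
  | succ k ih =>
    rw [List.ofFn_succ, List.ofFn_succ]
    refine ⟨s 0, hs 0, h₁ 0, h₂ 0, ?_⟩
    rw [Fin.sum_univ_succ, add_sub_cancel_left]
    exact ih _ _ _ (fun i => hs _) (fun i => h₁ _) (fun i => h₂ _)

theorem PartitionInstance.isPositive_iff (A : PartitionInstance) :
    A.IsPositive ↔ Attains (List.ofFn fun i => (A.a i : ℕ)) 0 := by
  rw [attains_ofFn]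
  constructor
  · rintro ⟨J, hJ⟩
    refine ⟨fun i => if i ∈ J then 1 else -1, fun i => ?_, ?_⟩
    · by_cases h : i ∈ J <;> simp [h]
    · rw [← Finset.sum_add_sum_compl J]
      have h₁ : ∑ i ∈ J, (if i ∈ J then (1 : ℤ) else -1) * ((A.a i : ℕ) : ℤ) =
          ∑ i ∈ J, ((A.a i : ℕ) : ℤ) := Finset.sum_congr rfl fun i hi => by simp [hi]
      have h₂ : ∑ i ∈ Jᶜ, (if i ∈ J then (1 : ℤ) else -1) * ((A.a i : ℕ) : ℤ) =
          -∑ i ∈ Jᶜ, ((A.a i : ℕ) : ℤ) := by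
        rw [← Finset.sum_neg_distrib]
        exact Finset.sum_congr rfl fun i hi => by simp [Finset.mem_compl.1 hi]
      rw [h₁, h₂, ← Nat.cast_sum, ← Nat.cast_sum, hJ, add_neg_cancel]
  · rintro ⟨s, hs, h⟩
    refine ⟨Finset.univ.filter fun i => s i = 1, ?_⟩
    rw [← Finset.sum_add_sum_compl (Finset.univ.filter fun i => s i = 1)] at h
    have h₁ : ∑ i with s i = 1, s i * ((A.a i : ℕ) : ℤ) =
        ∑ i with s i = 1, ((A.a i : ℕ) : ℤ) :=
      Finset.sum_congr rfl fun i hi => by rw [(Finset.mem_filter.1 hi).2, one_mul]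
    have h₂ : ∑ i ∈ (Finset.univ.filter fun i => s i = 1)ᶜ, s i * ((A.a i : ℕ) : ℤ) =
        -∑ i ∈ (Finset.univ.filter fun i => s i = 1)ᶜ, ((A.a i : ℕ) : ℤ) := by
      rw [← Finset.sum_neg_distrib]
      refine Finset.sum_congr rfl fun i hi => ?_
      have : s i ≠ 1 := by simpa using hi
      rw [(hs i).resolve_left this]
      ring
    rw [h₁, h₂, ← Nat.cast_sum, ← Nat.cast_sum] at h
    omega

theorem exists_filled_of_attains {k : ℕ} (f : Fin k → ℕ) (h : Attains (List.ofFn f) 0) :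
    ∃ η ∈ feasible fun i => (f i : ℝ), ∀ i, Filled (fun i => (f i : ℝ)) η i := by
  obtain ⟨s, hs, h⟩ := (attains_ofFn f 0).1 h
  refine ⟨fun i => s i * f i, ⟨fun i => ?_, ?_⟩, fun i => ?_⟩
  · have := Nat.cast_nonneg (α := ℝ) (f i)
    rcases hs i with h | h <;> simp only [h, Set.mem_Icc] <;> push_cast <;>
      constructor <;> linarith
  · simpa using congrArg (Int.cast : ℤ → ℝ) h
  · rcases hs i with h | h <;> simp [Filled, h]

theorem filled_iff_isPositive (A : PartitionInstance) (ξ : Fin A.k → ℝ)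
    (hξ : IsMaximizer (fun i => ((A.a i : ℕ) : ℝ)) ξ) :
    (∀ i, Filled (fun i => ((A.a i : ℕ) : ℝ)) ξ i) ↔ A.IsPositive := by
  rw [A.isPositive_iff]
  constructor
  · intro h
    refine (attains_ofFn _ _).2 ⟨fun i => if ξ i = (A.a i : ℕ) then 1 else -1, fun i => ?_, ?_⟩
    · by_cases h : ξ i = (A.a i : ℕ) <;> simp [h]
    · have key : ∀ i, (((if ξ i = (A.a i : ℕ) then 1 else -1) * ((A.a i : ℕ) : ℤ) : ℤ) : ℝ) =
          ξ i := by
        intro i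
        by_cases hi : ξ i = (A.a i : ℕ)
        · simp [hi]
        · rw [(h i).resolve_left hi, if_neg (by rwa [← (h i).resolve_left hi])]
          simp
      have := hξ.1.2
      rw [← Finset.sum_congr rfl fun i _ => key i] at this
      exact_mod_cast this
  · intro h
    obtain ⟨η, hη, hfill⟩ := exists_filled_of_attains _ h
    exact hξ.filled (fun i => Nat.cast_nonneg _) hη hfill

/-- If a sign sum vanishes, then some vanishing sign sum agrees with every solution. -/
theorem IsSolution.attainsWith {k : ℕ} {f : Fin k → ℕ} {Jp Jm : Finset (Fin k)}
    (h : IsSolution (fun i => (f i : ℝ)) Jp Jm) (h0 : Attains (List.ofFn f) 0) :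
    AttainsWith (List.ofFn f) (encodePair Jp Jm) 0 := by
  obtain ⟨ξ, hξ, hd, -, hp, hm, -⟩ := h
  obtain ⟨η, hη, hfill⟩ := exists_filled_of_attains _ h0
  have hfilled := hξ.filled (fun i => Nat.cast_nonneg _) hη hfill
  have hs : ∀ i, ∃ s : ℤ, (s = 1 ∨ s = -1) ∧ (i ∈ Jp → s = 1) ∧ (i ∈ Jm → s = -1) ∧
      (s : ℝ) * f i = ξ i := by
    intro i
    by_cases hip : i ∈ Jp
    · refine ⟨1, Or.inl rfl, fun _ => rfl, fun him => ?_, by simp [hp i hip]⟩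
      exact absurd him (Finset.disjoint_left.1 hd hip)
    · by_cases him : i ∈ Jm
      · exact ⟨-1, Or.inr rfl, fun hip' => absurd hip' hip, fun _ => rfl, by simp [hm i him]⟩
      -- The index outside both sets has no prescribed sign; it gets one because the maximizer is
      -- filled there too.
      · rcases hfilled i with hi | hi
        · exact ⟨1, Or.inl rfl, fun h => absurd h hip, fun h => absurd h him, by simp [hi]⟩
        · exact ⟨-1, Or.inr rfl, fun h => absurd h hip, fun h => absurd h him, by simp [hi]⟩
  choose s hs hsp hsm hsξ using hs
  have hsum := hξ.1.2
  rw [← Finset.sum_congr rfl fun i _ => hsξ i] at hsum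
  have hsum' : ∑ i, s i * (f i : ℤ) = 0 := by exact_mod_cast hsum
  rw [← hsum']
  exact attainsWith_ofFn _ _ s hs (fun i hi => hsp i (by simpa using hi))
    (fun i hi => hsm i (by simpa using hi))

/-- At most one index of a solution belongs to neither of the two sets. -/
theorem IsSolution.pairwise {k : ℕ} {β : Fin k → ℝ} {Jp Jm : Finset (Fin k)}
    (h : IsSolution β Jp Jm) :
    (encodePair Jp Jm).Pairwise fun c d => c = (false, false) → d ≠ (false, false) := by
  obtain ⟨ξ, -, hd, hcard, -⟩ := h
  rw [encodePair, List.pairwise_ofFn]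
  intro i j hij hi hj
  simp only [Prod.mk.injEq, decide_eq_false_iff_not] at hi hj
  -- Two indices outside both sets would leave at most k - 2 for the union, which has k - 1
  -- elements.
  have hsub : Jp ∪ Jm ⊆ {i, j}ᶜ := by
    intro a ha
    simp only [Finset.mem_compl, Finset.mem_insert, Finset.mem_singleton]
    rintro (rfl | rfl) <;> simp_all
  have := Finset.card_le_card hsub
  rw [Finset.card_union_of_disjoint hd, Finset.card_compl, Finset.card_pair hij.ne,
    Fintype.card_fin] at this
  have := i.2
  have := j.2
  have := Fin.lt_def.1 hij
  omega

end SignSums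

/-! ### The padded list and the recovery of a partition from it. -/

section Padding

/-- The number of zeros between the leading digit of a padded number and the digits of the
original one. -/
def padding (N : ℕ) (l : List ℕ) : ℕ := N + (l.map fun a => a.size + 1).sum

/-- Each number `a` of the list is replaced by a pair `2 ^ p + a`, `2 ^ p`. -/
def padded (N : ℕ) : List ℕ → List ℕ
  -- The zeros do not change sign sums and secure at least two entries even for an empty list.
  | [] => [0, 0]
  | a :: l => (2 ^ (padding N l + a.size) + a) :: 2 ^ (padding N l + a.size) :: padded N l

theorem padding_cons (N a : ℕ) (l : List ℕ) :
    padding N (a :: l) = padding N l + a.size + 1 := by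
  simp only [padding, List.map_cons, List.sum_cons]
  omega

theorem le_padding (N : ℕ) (l : List ℕ) : N ≤ padding N l := Nat.le_add_right _ _

theorem length_padded (N : ℕ) (l : List ℕ) : (padded N l).length = 2 * l.length + 2 := by
  induction l with
  | nil => rfl
  | cons a l ih => simp only [padded, List.length_cons, ih]; ring

theorem pow_add_lt {z a : ℕ} : 2 ^ (z + a.size) + a < 2 ^ (z + a.size + 1) := by
  have h₁ : a < 2 ^ a.size := Nat.lt_size_self a
  have h₂ : 2 ^ a.size ≤ 2 ^ (z + a.size) := Nat.pow_le_pow_right two_pos (Nat.le_add_left _ _)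
  rw [pow_succ]
  omega

/-- The next exponent is at least `padding N l`, so this bound makes the list nonincreasing without
any sorting. -/
theorem le_two_pow_of_mem_padded {N : ℕ} {l : List ℕ} {x : ℕ} (hx : x ∈ padded N l) :
    x ≤ 2 ^ padding N l := by
  induction l with
  | nil =>
    have : x = 0 := by simpa [padded] using hx
    simp [this]
  | cons a l ih =>
    have h := pow_add_lt (z := padding N l) (a := a)
    rw [padding_cons]
    simp only [padded, List.mem_cons] at hx
    rcases hx with rfl | rfl | hx
    · exact h.le
    · omega
    · exact (ih hx).trans (Nat.pow_le_pow_right two_pos (by omega))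

theorem pairwise_padded (N : ℕ) (l : List ℕ) : (padded N l).Pairwise (· ≥ ·) := by
  induction l with
  | nil => simp [padded]
  | cons a l ih =>
    have h : ∀ x ∈ padded N l, x ≤ 2 ^ (padding N l + a.size) := fun x hx =>
      (le_two_pow_of_mem_padded hx).trans (Nat.pow_le_pow_right two_pos (Nat.le_add_right _ _))
    refine List.pairwise_cons.2 ⟨fun x hx => ?_, List.pairwise_cons.2 ⟨h, ih⟩⟩
    rcases List.mem_cons.1 hx with rfl | hx
    · exact Nat.le_add_right _ _
    · exact (h x hx).trans (Nat.le_add_right _ _)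

/-- Opposite signs within each pair cancel the powers of two and leave ±a. -/
theorem Attains.padded (N : ℕ) {l : List ℕ} {x : ℤ} (h : Attains l x) :
    Attains (padded N l) x := by
  induction l generalizing x with
  | nil => simpa [AMCCR.padded, Attains] using h
  | cons a l ih =>
    simp only [AMCCR.padded, Attains]
    push_cast
    rcases h with h | h
    · left; right
      convert ih h using 1
      ring
    · right; left
      convert ih h using 1
      ring

theorem AttainsWith.natAbs_le {l : List ℕ} {cs : List (Bool × Bool)} {x : ℤ}
    (h : AttainsWith l cs x) : |x| ≤ (l.sum : ℤ) := by
  induction l generalizing cs x with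
  | nil => simp [show x = 0 from h]
  | cons a l ih =>
    cases cs with
    | nil => exact h.elim
    | cons c cs =>
      obtain ⟨s, hs, -, -, h⟩ := h
      have := abs_le.1 (ih h)
      rw [List.sum_cons, abs_le, Nat.cast_add]
      rcases hs with rfl | rfl <;> constructor <;> linarith

/-- Positivity gives `1 ≤ a.size`, so the sum of the later entries stays below the power of two in
the current pair; with a below that power too, the total is less than four times it. -/
theorem sum_padded_lt {N : ℕ} {l : List ℕ} (hl : ∀ a ∈ l, 0 < a) :
    (padded N l).sum < 2 ^ (padding N l + 1) := by
  induction l with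
  | nil => simp [padded]
  | cons a l ih =>
    have hp := Nat.size_pos.2 (hl a (by simp))
    have h := ih fun b hb => hl b (by simp [hb])
    have h₁ : 2 ^ (padding N l + 1) ≤ 2 ^ (padding N l + a.size) :=
      Nat.pow_le_pow_right two_pos (by omega)
    have h₂ := pow_add_lt (z := padding N l) (a := a)
    rw [padding_cons, pow_succ _ (_ + 1)]
    rw [pow_succ] at h₂ ⊢
    simp only [padded, List.sum_cons]
    omega

/-- The sign of a number, read off the codes of the two padded numbers that stand for it: `true`
stands for minus. -/
def isNeg (y x : Bool × Bool) : Bool := !y.1 && (y.2 || x.1)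

/-- The sum of the list with the signs given by the codes. -/
def signedSum : List ℕ → List (Bool × Bool) → ℤ
  | a :: l, y :: x :: cs => (if isNeg y x then -(a : ℤ) else a) + signedSum l cs
  | _, _ => 0

/-- Soundness: nothing is assumed about the meaning of the codes, so a zero sum always certifies a
partition. -/
theorem attains_signedSum {l : List ℕ} {cs : List (Bool × Bool)} (h : 2 * l.length ≤ cs.length) :
    Attains l (signedSum l cs) := by
  induction l generalizing cs with
  | nil => simp [signedSum, Attains]
  | cons a l ih =>
    match cs with
    | [] => simp at h
    | [_] => simp at h; omega
    | y :: x :: cs =>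
      have := ih (cs := cs) (by simp at h; omega)
      rw [signedSum, Attains]
      split_ifs
      · right; simpa using this
      · left; simpa using this

/-- Completeness: the leading pair dominates everything after it, which forces opposite signs; at
most one code of the pair is unset, so the other determines both signs. The bound on |x| plus the
remaining sum is preserved when ±a is removed. -/
theorem signedSum_eq {N : ℕ} {l : List ℕ} {cs : List (Bool × Bool)} {x : ℤ}
    (hl : ∀ a ∈ l, 0 < a)
    (hcs : cs.Pairwise fun c d => c = (false, false) → d ≠ (false, false))
    (hx : |x| + (l.sum : ℤ) < 2 ^ N) (h : AttainsWith (padded N l) cs x) :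
    signedSum l cs = x := by
  induction l generalizing cs x with
  | nil =>
    have := h.natAbs_le
    have : x = 0 := by simpa [padded] using this
    simp [signedSum, this]
  | cons a l ih =>
    match cs with
    | [] => exact h.elim
    | [_] => obtain ⟨s, -, -, -, h⟩ := h; exact h.elim
    | c :: d :: cs =>
      obtain ⟨s, hs, hc₁, hc₂, t, ht, hd₁, hd₂, h⟩ := h
      rw [List.pairwise_cons, List.pairwise_cons] at hcs
      have hcd := hcs.1 d (by simp)
      have hrest := h.natAbs_le
      have hsum := sum_padded_lt (N := N) (l := l) fun b hb => hl b (by simp [hb])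
      have hp := Nat.size_pos.2 (hl a (by simp))
      have h₁ : 2 ^ (padding N l + 1) ≤ 2 ^ (padding N l + a.size) :=
        Nat.pow_le_pow_right two_pos (by omega)
      have h₂ : 2 ^ N ≤ 2 ^ (padding N l + a.size) :=
        Nat.pow_le_pow_right two_pos ((le_padding N l).trans (Nat.le_add_right _ _))
      have hsum' : ((padded N l).sum : ℤ) < 2 ^ (padding N l + 1) := by exact_mod_cast hsum
      have h₁' : (2 : ℤ) ^ (padding N l + 1) ≤ 2 ^ (padding N l + a.size) := by exact_mod_cast h₁
      have h₂' : (2 : ℤ) ^ N ≤ 2 ^ (padding N l + a.size) := by exact_mod_cast h₂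
      rw [Nat.cast_add, Nat.cast_pow, Nat.cast_two] at h hrest
      rw [List.sum_cons, Nat.cast_add] at hx
      set P : ℤ := 2 ^ (padding N l + a.size)
      have h₃ := abs_le.1 hrest
      have h₄ := neg_abs_le x
      have h₅ := le_abs_self x
      have h₆ : (0 : ℤ) ≤ l.sum := Nat.cast_nonneg _
      -- Equal signs would leave at least 2P + a - |x| > P for the later entries to attain, but
      -- their sum is less than P.
      have hst : t = -s := by
        rcases hs with rfl | rfl <;> rcases ht with rfl | rfl <;>
          first | rfl | (exfalso; linarith)
      subst hst
      have hrec := ih (x := x - s * a) (fun b hb => hl b (by simp [hb])) hcs.2.2 (by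
        have h₇ : |(a : ℤ)| = a := abs_of_nonneg (Nat.cast_nonneg _)
        rcases hs with rfl | rfl
        · have := abs_sub x a
          rw [one_mul]; linarith
        · have := abs_add_le x a
          rw [neg_one_mul, sub_neg_eq_add]; linarith) (by
        convert h using 1; ring)
      rw [signedSum, hrec]
      obtain ⟨c₁, c₂⟩ := c
      obtain ⟨d₁, d₂⟩ := d
      -- Finite check that `isNeg` returns the sign s; `hcd` rules out the case of two unset codes.
      rcases hs with rfl | rfl <;> cases c₁ <;> cases c₂ <;> cases d₁ <;> cases d₂ <;>
        simp [isNeg] at hcd hc₁ hc₂ hd₁ hd₂ ⊢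

theorem sum_lt_two_pow_padding (l : List ℕ) : l.sum < 2 ^ padding 0 l := by
  induction l with
  | nil => simp [padding]
  | cons a l ih =>
    rw [padding_cons, List.sum_cons]
    have h₁ := pow_add_lt (z := padding 0 l) (a := a)
    have h₂ : 2 ^ padding 0 l ≤ 2 ^ (padding 0 l + a.size) :=
      Nat.pow_le_pow_right two_pos (Nat.le_add_right _ _)
    omega

/-- The AMCCR instance built from a list of natural numbers. -/
def paddedInstance (N : ℕ) (l : List ℕ) : Instance where
  k := (padded N l).length
  two_le := by rw [length_padded]; omega
  β i := ((padded N l).get i : ℚ≥0)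
  antitone i j hij := by
    rcases hij.eq_or_lt with rfl | hij
    · exact le_rfl
    · exact Nat.cast_le.2 (List.pairwise_iff_get.1 (pairwise_padded N l) i j hij)

/-- The numbers of a PARTITION instance, in reverse order. -/
def PartitionInstance.reversed (A : PartitionInstance) : List ℕ :=
  (List.ofFn fun i => (A.a i : ℕ)).reverse

theorem PartitionInstance.pos_of_mem_reversed (A : PartitionInstance) :
    ∀ a ∈ A.reversed, 0 < a := by
  intro a ha
  obtain ⟨i, rfl⟩ : ∃ i, (A.a i : ℕ) = a := by simpa [reversed, List.mem_ofFn] using ha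
  exact (A.a i).pos

/-- Soundness gives one direction. For the other, a partition yields a filled point of the padded
instance, so the solver's signs extend to a vanishing sum; `hN` puts the total of the original
numbers below 2^N. -/
theorem signedSum_eq_zero_iff (A : PartitionInstance) (N : ℕ) (hN : padding 0 A.reversed ≤ N)
    {Jp Jm : Finset (Fin (paddedInstance N A.reversed).k)}
    (h : IsSolution (fun i => ((paddedInstance N A.reversed).β i : ℝ)) Jp Jm) :
    signedSum A.reversed (encodePair Jp Jm) = 0 ↔ A.IsPositive := by
  rw [A.isPositive_iff]
  have hlen : (encodePair Jp Jm).length = 2 * A.reversed.length + 2 := by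
    rw [encodePair, List.length_ofFn]
    exact length_padded _ _
  constructor
  · intro h0
    have := attains_signedSum (l := A.reversed) (cs := encodePair Jp Jm) (by omega)
    rw [h0] at this
    exact this.perm (List.reverse_perm _)
  · intro h0
    have h1 : Attains (padded N A.reversed) 0 :=
      Attains.padded N (h0.perm (List.reverse_perm _).symm)
    have h' : IsSolution (fun i => (((padded N A.reversed).get i : ℕ) : ℝ)) Jp Jm := by
      simpa [paddedInstance] using h
    have h2 := h'.attainsWith (by rwa [List.ofFn_get])
    rw [List.ofFn_get] at h2
    refine signedSum_eq A.pos_of_mem_reversed h'.pairwise ?_ h2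
    have h3 := (sum_lt_two_pow_padding A.reversed).trans_le (Nat.pow_le_pow_right two_pos hN)
    rw [abs_zero, zero_add]
    exact_mod_cast h3

end Padding

/-! ### Binary codes of padded instances and their lengths. -/

section Encoding

/-- The power of two lies above all digits of a, so no carry occurs and the padded number is a
concatenation of words. -/
theorem bits_two_pow_add (z a : ℕ) :
    (2 ^ (z + a.size) + a).bits = a.bits ++ List.replicate z false ++ [true] := by
  induction a using Nat.binaryRec' with
  | zero =>
    induction z with
    | zero => simp
    | succ z ih =>
      have h : 2 ^ (z + 1 + Nat.size 0) + 0 = 2 * (2 ^ (z + Nat.size 0) + 0) := by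
        rw [Nat.size_zero]; ring
      rw [h, Nat.bit0_bits _ (by positivity), ih]
      simp [List.replicate_succ]
  | bit b n h ih =>
    have h0 : Nat.bit b n ≠ 0 := by
      intro h'
      obtain ⟨rfl, rfl⟩ := Nat.bit_eq_zero_iff.1 h'
      simpa using h rfl
    have h1 : 2 ^ (z + (Nat.bit b n).size) + Nat.bit b n = Nat.bit b (2 ^ (z + n.size) + n) := by
      rw [Nat.size_bit h0, Nat.bit_val, Nat.bit_val, Nat.succ_eq_add_one, ← add_assoc z, pow_succ]
      ring
    have h2 : 2 ^ (z + n.size) + n ≠ 0 := by positivity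
    rw [h1, Nat.bits_append_bit _ _ (fun h' => absurd h' h2), Nat.bits_append_bit _ _ h, ih]
    rfl

/-- The last symbols of the code of a positive integer, from the leading digit on. -/
def leading : List Symbol := [.bit true, .slash, .bit true, .comma]

/-- The code of a pair of padded numbers. -/
def pairCode (z : ℕ) (l : List Bool) : List Symbol :=
  (l.map .bit ++ List.replicate z (.bit false) ++ leading) ++
    (List.replicate l.length (.bit false) ++ List.replicate z (.bit false) ++ leading)

/-- The code of the final zeros of a padded instance. -/
def zeros : List Symbol := [.slash, .bit true, .comma, .slash, .bit true, .comma]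

/-- The code of a padded instance. -/
def paddedCode (N : ℕ) : List ℕ → List Symbol
  | [] => zeros
  | a :: l => pairCode (padding N l) a.bits ++ paddedCode N l

theorem encode_paddedInstance (N : ℕ) (l : List ℕ) :
    (paddedInstance N l).encode = paddedCode N l := by
  have h : List.ofFn (paddedInstance N l).β = (padded N l).map fun m : ℕ => (m : ℚ≥0) := by
    rw [← List.ofFn_get ((padded N l).map _)]
    simp only [paddedInstance]
    apply List.ext_get <;> simp
  rw [Instance.encode, h, List.flatMap_map]
  clear h
  induction l with
  | nil => simp [padded, paddedCode, zeros, encodeNatural, Nat.one_bits]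
  | cons a l ih =>
    rw [padded, List.flatMap_cons, List.flatMap_cons, ih, paddedCode, pairCode]
    have h : (2 ^ (padding N l + a.size)).bits =
        List.replicate a.bits.length false ++ List.replicate (padding N l) false ++ [true] := by
      have := bits_two_pow_add (padding N l + a.size) 0
      rw [Nat.size_zero, add_zero, add_zero, Nat.zero_bits, List.nil_append] at this
      rw [this, Nat.size_eq_bits_len, List.replicate_append_replicate, add_comm]
    simp only [NNRat.num_natCast, NNRat.den_natCast, encodeNatural, bits_two_pow_add, h,
      Nat.one_bits, leading, List.map_append, List.map_replicate, List.map_cons, List.map_nil,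
      List.append_assoc, List.cons_append, List.nil_append]

theorem length_paddedCode_le (N : ℕ) (l : List ℕ) :
    (paddedCode N l).length ≤ l.length * (2 * padding N l + 8) + 6 := by
  induction l with
  | nil => simp [paddedCode, zeros]
  | cons a l ih =>
    have h : (pairCode (padding N l) a.bits).length ≤ 2 * padding N (a :: l) + 8 := by
      rw [padding_cons, ← Nat.size_eq_bits_len]
      simp only [pairCode, leading, List.length_append, List.length_map, List.length_replicate,
        List.length_cons, List.length_nil]
      omega
    have h' : l.length * (2 * padding N l + 8) ≤ l.length * (2 * padding N (a :: l) + 8) :=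
      Nat.mul_le_mul_left _ (by rw [padding_cons]; omega)
    rw [paddedCode, List.length_append, List.length_cons, add_mul, one_mul]
    omega

/-- The code of a list of natural numbers. -/
def listCode (l : List ℕ) : List Symbol :=
  l.flatMap fun a => a.bits.map .bit ++ [.comma]

theorem PartitionInstance.encode_eq (A : PartitionInstance) :
    A.encode = listCode (List.ofFn fun i => (A.a i : ℕ)) := by
  have : (List.ofFn fun i => (A.a i : ℕ)) = (List.ofFn A.a).flatMap fun n : ℕ+ => [(n : ℕ)] := by
    rw [← List.map_eq_flatMap, List.map_ofFn]; rfl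
  rw [this]
  rfl

theorem listCode_cons (a : ℕ) (l : List ℕ) :
    listCode (a :: l) = a.bits.map .bit ++ .comma :: listCode l := by
  simp [listCode]

/-- This explains the summand `a.size + 1` in `padding`: one unit for each digit and one for the end
marker, so the machine obtains the padding by counting symbols. -/
theorem length_listCode (l : List ℕ) : (listCode l).length = padding 0 l := by
  induction l with
  | nil => simp [listCode, padding]
  | cons a l ih =>
    rw [listCode_cons, padding_cons, ← ih, ← Nat.size_eq_bits_len]
    simp only [List.length_append, List.length_map, List.length_cons]
    omega

theorem padding_reverse (N : ℕ) (l : List ℕ) : padding N l.reverse = padding N l := by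
  rw [padding, padding, List.map_reverse, List.sum_reverse]

theorem length_le_padding (N : ℕ) (l : List ℕ) : l.length ≤ padding N l := by
  induction l with
  | nil => simp
  | cons a l ih => rw [padding_cons, List.length_cons]; omega

end Encoding

/-! ### Addition in signed binary digits. -/

section SignedDigits

/-- The integer with the given signed binary digits, the least significant one first. -/
def digitsValue : List SignType → ℤ
  | [] => 0
  | d :: l => d + 2 * digitsValue l

/-- By parity the lowest digit of a zero value is 0; then halve and repeat. Redundancy of the
notation thus does not affect the zero test. -/
theorem digitsValue_eq_zero_iff (l : List SignType) :
    digitsValue l = 0 ↔ l.all (fun d => decide (d = 0)) = true := by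
  induction l with
  | nil => simp [digitsValue]
  | cons d l ih =>
    rw [List.all_cons, Bool.and_eq_true, ← ih, digitsValue]
    rcases d with _ | _ | _ <;> simp <;> omega

/-- The carry of a sum of signed digits. -/
def carryOf (n : ℤ) : SignType := if 2 ≤ n then 1 else if n ≤ -2 then -1 else 0

/-- The remaining digit of a sum of signed digits. -/
def digitOf (n : ℤ) : SignType := if n % 2 = 0 then 0 else if 0 < n then 1 else -1

/-- The sum of a signed digit, a signed bit and a carry. -/
def digitSum (neg : Bool) (d : Option SignType) (b : Bool) (c : SignType) : ℤ :=
  (d.getD 0 : ℤ) + (if b then (if neg then -1 else 1) else 0) + c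

/-- The sum lies between -3 and 3, so a carry in {-1, 0, 1} always suffices. -/
theorem digitOf_add_carryOf (neg : Bool) (d : Option SignType) (b : Bool) (c : SignType) :
    (digitOf (digitSum neg d b c) : ℤ) + 2 * carryOf (digitSum neg d b c) =
      digitSum neg d b c := by
  revert neg d b c
  decide

/-- Addition of a signed binary number to a sequence of signed digits. -/
def addDigits (neg : Bool) : SignType → List Bool → List SignType → List SignType
  | c, b :: l, acc =>
    digitOf (digitSum neg acc.head? b c) ::
      addDigits neg (carryOf (digitSum neg acc.head? b c)) l acc.tail
  | c, [], d :: acc =>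
    digitOf (digitSum neg (some d) false c) ::
      addDigits neg (carryOf (digitSum neg (some d) false c)) [] acc
  | c, [], [] => [c]

theorem length_addDigits (neg : Bool) (c : SignType) (l : List Bool) (acc : List SignType) :
    (addDigits neg c l acc).length = max l.length acc.length + 1 := by
  induction l generalizing c acc with
  | nil =>
    induction acc generalizing c with
    | nil => simp [addDigits]
    | cons d acc ih => simp [addDigits, ih]
  | cons b l ih =>
    rw [addDigits, List.length_cons, ih, List.length_tail, List.length_cons]
    omega

theorem digitsValue_addDigits (neg : Bool) (c : SignType) (n : ℕ) (acc : List SignType) :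
    digitsValue (addDigits neg c n.bits acc) =
      digitsValue acc + (if neg then -(n : ℤ) else n) + c := by
  induction n using Nat.binaryRec' generalizing c acc with
  | zero =>
    rw [Nat.zero_bits]
    induction acc generalizing c with
    | nil => simp [addDigits, digitsValue]
    | cons d acc ih =>
      have := digitOf_add_carryOf neg (some d) false c
      simp only [digitSum, Option.getD_some, Bool.false_eq_true, if_false] at this
      simp only [addDigits, digitsValue, ih, digitSum, Option.getD_some, Bool.false_eq_true,
        if_false]
      simp only [Nat.cast_zero, neg_zero, ite_self]
      linarith
  | bit b n h ih =>
    rw [Nat.bits_append_bit _ _ h, addDigits, digitsValue, ih]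
    have h₁ := digitOf_add_carryOf neg acc.head? b c
    have h₂ : digitsValue acc = (acc.head?.getD 0 : SignType) + 2 * digitsValue acc.tail := by
      cases acc <;> simp [digitsValue]
    rw [h₂, Nat.bit_val]
    simp only [digitSum] at h₁ ⊢
    cases b <;> cases neg <;> simp at h₁ ⊢ <;> linarith

end SignedDigits

/-! ### Time-bounded reachability. -/

section Runs

/-- The configuration `b` is reached from `a` in at most `t` steps. -/
def RunsIn {C : Type*} (f : C → Option C) (t : ℕ) (a b : C) : Prop :=
  ∃ n ≤ t, (flip bind f)^[n] (some a) = some b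

namespace RunsIn

variable {C : Type*} {f : C → Option C}

theorem trans {s t : ℕ} {a b c : C} (h₁ : RunsIn f s a b) (h₂ : RunsIn f t b c) :
    RunsIn f (s + t) a c := by
  obtain ⟨m, hm, h₁⟩ := h₁
  obtain ⟨n, hn, h₂⟩ := h₂
  exact ⟨n + m, by omega, by rw [Function.iterate_add_apply, h₁, h₂]⟩

theorem single {a b : C} (h : f a = some b) : RunsIn f 1 a b := ⟨1, le_rfl, h⟩

theorem head {t : ℕ} {a b c : C} (h : f a = some b) (h' : RunsIn f t b c) :
    RunsIn f (t + 1) a c := by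
  rw [add_comm]
  exact (single h).trans h'

theorem mono {s t : ℕ} {a b : C} (h : RunsIn f s a b) (hst : s ≤ t) : RunsIn f t a b := by
  obtain ⟨n, hn, h⟩ := h
  exact ⟨n, hn.trans hst, h⟩

theorem congr {t : ℕ} {a a' b b' : C} (h : RunsIn f t a b) (ha : a' = a) (hb : b' = b) :
    RunsIn f t a' b' := by
  rwa [ha, hb]

end RunsIn

end Runs

/-! ### The combined machine. -/

section Machine

/-- The stacks of the machine apart from those of the AMCCR machine. -/
inductive Tape where
  | inp | rev | sav | cnt | cnt' | acc | tmp | out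
  deriving DecidableEq

instance : Fintype Tape :=
  Fintype.ofList [.inp, .rev, .sav, .cnt, .cnt', .acc, .tmp, .out] (by rintro ⟨⟩ <;> simp)

/-- The symbols on each stack. -/
@[reducible] def Tape.Alphabet : Tape → Type
  | inp => Symbol
  | rev => Symbol
  | sav => Symbol
  | cnt => Unit
  | cnt' => Unit
  | acc => SignType
  | tmp => SignType
  | out => Bool

/-- The contents of all stacks apart from those of the AMCCR machine. -/
structure Tapes where
  inp : List Symbol := []
  rev : List Symbol := []
  sav : List Symbol := []
  cnt : List Unit := []
  cnt' : List Unit := []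
  acc : List SignType := []
  tmp : List SignType := []
  out : List Bool := []

/-- The content of a stack. -/
def Tapes.get (T : Tapes) : ∀ k : Tape, List k.Alphabet
  | .inp => T.inp
  | .rev => T.rev
  | .sav => T.sav
  | .cnt => T.cnt
  | .cnt' => T.cnt'
  | .acc => T.acc
  | .tmp => T.tmp
  | .out => T.out

/-- Replace the content of a stack. -/
def Tapes.set (T : Tapes) : ∀ k : Tape, List k.Alphabet → Tapes
  | .inp, l => { T with inp := l }
  | .rev, l => { T with rev := l }
  | .sav, l => { T with sav := l }
  | .cnt, l => { T with cnt := l }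
  | .cnt', l => { T with cnt' := l }
  | .acc, l => { T with acc := l }
  | .tmp, l => { T with tmp := l }
  | .out, l => { T with out := l }

/-- The registers of the machine. -/
structure Reg where
  sym : Option Symbol := none
  dig : Option SignType := none
  more : Bool := false
  code : Bool × Bool := (false, false)
  carry : SignType := 0
  neg : Bool := false
  -- The default starts the final conjunction over the digits in phase `check`.
  flag : Bool := true

noncomputable instance : Fintype Reg :=
  Fintype.ofInjective (fun r : Reg => (r.sym, r.dig, r.more, r.code, r.carry, r.neg, r.flag))
    fun r s h => by cases r; cases s; simpa using h

/-- The labels of the machine apart from those of the AMCCR machine. -/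
inductive Phase where
  | count | back | loop | padX | bitsX | padY | bitsY | clear
  | sign | addBits | addRest | unrev | check
  deriving DecidableEq

instance : Fintype Phase :=
  Fintype.ofList [.count, .back, .loop, .padX, .bitsX, .padY, .bitsY, .clear, .sign, .addBits,
    .addRest, .unrev, .check] (by rintro ⟨⟩ <;> simp)

variable (tm : Turing.FinTM2)

/-- The symbols on each stack of the combined machine. -/
@[reducible] def Alphabet : tm.K ⊕ Tape → Type
  | .inl k => tm.Γ k
  | .inr k => k.Alphabet

/-- The statements of the combined machine. -/
abbrev Code := Turing.TM2.Stmt (Alphabet tm) (tm.Λ ⊕ Phase) (tm.σ × Reg)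

/-- The configurations of the combined machine. -/
abbrev Conf := Turing.TM2.Cfg (Alphabet tm) (tm.Λ ⊕ Phase) (tm.σ × Reg)

open Turing.TM2 (stepAux)
open Turing.TM2.Stmt

/-- A statement of the AMCCR machine as one of the combined machine. -/
def embed : Turing.TM2.Stmt tm.Γ tm.Λ tm.σ → Code tm
  | push k f q => push (Sum.inl k) (fun v => f v.1) (embed q)
  | peek k f q => peek (Sum.inl k) (fun v s => (f v.1 s, v.2)) (embed q)
  | pop k f q => pop (Sum.inl k) (fun v s => (f v.1 s, v.2)) (embed q)
  | load f q => load (fun v => (f v.1, v.2)) (embed q)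
  | branch p q₁ q₂ => branch (fun v => p v.1) (embed q₁) (embed q₂)
  | goto f => goto fun v => Sum.inl (f v.1)
  -- Instead of halting, the solver hands control to the evaluation of its answer.
  | halt => goto fun _ => Sum.inr .sign

variable {tm}

/-- The contents of all stacks. -/
def allStacks (w : ∀ k, List (tm.Γ k)) (T : Tapes) : ∀ k, List (Alphabet tm k)
  | .inl k => w k
  | .inr k => T.get k

theorem update_allStacks_inl (w : ∀ k, List (tm.Γ k)) (T : Tapes) (k : tm.K) (l : List (tm.Γ k)) :
    Function.update (allStacks w T) (Sum.inl k) l = allStacks (Function.update w k l) T := by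
  funext j
  rcases j with j | j
  · by_cases h : j = k
    · subst h
      simp [allStacks]
    · rw [Function.update_of_ne (by simpa using h)]
      simp [allStacks, h]
  · rw [Function.update_of_ne (by simp)]
    rfl

theorem update_allStacks_inr (w : ∀ k, List (tm.Γ k)) (T : Tapes) (k : Tape) (l : List k.Alphabet) :
    Function.update (allStacks w T) (Sum.inr k) l = allStacks w (T.set k l) := by
  funext j
  rcases j with j | j
  · rw [Function.update_of_ne (by simp)]
    rfl
  · by_cases h : j = k
    · subst h
      rw [Function.update_self]
      cases j <;> rfl
    · rw [Function.update_of_ne (by simpa using h)]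
      cases j <;> cases k <;> first | rfl | exact absurd rfl h

/-- A configuration of the AMCCR machine as one of the combined machine. -/
def embedCfg (r : Reg) (T : Tapes) (c : tm.Cfg) : Conf tm :=
  ⟨some (c.l.elim (Sum.inr .sign) Sum.inl), (c.var, r), allStacks c.stk T⟩

theorem stepAux_embed (q : Turing.TM2.Stmt tm.Γ tm.Λ tm.σ) (v : tm.σ) (r : Reg)
    (w : ∀ k, List (tm.Γ k)) (T : Tapes) :
    stepAux (embed tm q) (v, r) (allStacks w T) = embedCfg r T (stepAux q v w) := by
  induction q generalizing v w with
  | push k f q ih => rw [embed, stepAux, update_allStacks_inl]; exact ih _ _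
  | peek k f q ih => exact ih _ _
  | pop k f q ih => rw [embed, stepAux, update_allStacks_inl]; exact ih _ _
  | load f q ih => exact ih _ _
  | branch p q₁ q₂ ih₁ ih₂ =>
    rw [embed, stepAux, stepAux]
    cases h : p v
    · simpa [h] using ih₂ v w
    · simpa [h] using ih₁ v w
  | goto f => rfl
  | halt => rfl

variable (e₀ : tm.Γ tm.k₀ ≃ Symbol) (e₁ : tm.Γ tm.k₁ ≃ Bool × Bool)

/-- Write a word on the input stack of the AMCCR machine. -/
def emit : List Symbol → Code tm → Code tm
  | [], q => q
  | a :: l, q => emit l (push (Sum.inl tm.k₀) (fun _ => e₀.symm a) q)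

variable (tm) in
/-- The symbol read last. -/
def lastSymbol (v : tm.σ × Reg) : Symbol := v.2.sym.getD .comma

variable (tm) in
/-- The bit read last, if it was a bit. -/
def lastBit (v : tm.σ × Reg) : Option Bool :=
  match v.2.sym with
  | some (.bit b) => some b
  | _ => none

/-- The program of the combined machine. -/
def program : tm.Λ ⊕ Phase → Code tm
  | .inl l => embed tm (tm.m l)
  | .inr .count =>
    pop (Sum.inr .inp) (fun v s => (v.1, { sym := s })) <|
    branch (fun v => v.2.sym.isSome)
      (push (Sum.inr .rev) (lastSymbol tm) <| push (Sum.inr .cnt) (fun _ => ()) <|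
        goto fun _ => .inr .count)
      (goto fun _ => .inr .back)
  | .inr .back =>
    pop (Sum.inr .rev) (fun v s => (v.1, { sym := s })) <|
    branch (fun v => v.2.sym.isSome)
      (push (Sum.inr .inp) (lastSymbol tm) <| goto fun _ => .inr .back)
      -- A stack is filled from its bottom, so the end of the instance is written first.
      (emit e₀ zeros <| goto fun _ => .inr .loop)
  | .inr .loop =>
    peek (Sum.inr .inp) (fun v s => (v.1, { sym := s })) <|
    branch (fun v => v.2.sym.isSome)
      (emit e₀ leading <| goto fun _ => .inr .padX)
      (goto fun _ => .inr .clear)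
  | .inr .padX =>
    pop (Sum.inr .cnt) (fun v s => (v.1, { more := s.isSome })) <|
    branch (fun v => v.2.more)
      (push (Sum.inr .cnt') (fun _ => ()) <| emit e₀ [.bit false] <| goto fun _ => .inr .padX)
      (goto fun _ => .inr .bitsX)
  | .inr .bitsX =>
    pop (Sum.inr .inp) (fun v s => (v.1, { sym := s })) <|
    branch (fun v => (lastBit tm v).isSome)
      -- The digits of a are stored for the larger partner; the pure power of two gets a zero for
      -- each of them.
      (push (Sum.inr .rev) (lastSymbol tm) <| emit e₀ [.bit false] <| goto fun _ => .inr .bitsX)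
      (emit e₀ leading <| goto fun _ => .inr .padY)
  | .inr .padY =>
    pop (Sum.inr .cnt') (fun v s => (v.1, { more := s.isSome })) <|
    branch (fun v => v.2.more)
      (push (Sum.inr .cnt) (fun _ => ()) <| emit e₀ [.bit false] <| goto fun _ => .inr .padY)
      -- The extra unit counts the end marker, as in `padding_cons`; the digits are counted in
      -- `bitsY`.
      (push (Sum.inr .sav) (fun _ => .comma) <| push (Sum.inr .cnt) (fun _ => ()) <|
        goto fun _ => .inr .bitsY)
  | .inr .bitsY =>
    pop (Sum.inr .rev) (fun v s => (v.1, { sym := s })) <|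
    branch (fun v => v.2.sym.isSome)
      (push (Sum.inr .sav) (lastSymbol tm) <| push (Sum.inr .cnt) (fun _ => ()) <|
        push (Sum.inl tm.k₀) (fun v => e₀.symm (lastSymbol tm v)) <| goto fun _ => .inr .bitsY)
      (goto fun _ => .inr .loop)
  | .inr .clear =>
    pop (Sum.inr .cnt) (fun v s => (v.1, { more := s.isSome })) <|
    branch (fun v => v.2.more) (goto fun _ => .inr .clear) (goto fun _ => .inl tm.main)
  | .inr .sign =>
    peek (Sum.inr .sav) (fun v s => (v.1, { sym := s })) <|
    branch (fun v => v.2.sym.isSome)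
      (pop (Sum.inl tm.k₁) (fun v s => (v.1, { code := (s.map e₁).getD (false, false) })) <|
        pop (Sum.inl tm.k₁)
          (fun v s => (v.1, { neg := isNeg v.2.code ((s.map e₁).getD (false, false)) })) <|
        goto fun _ => .inr .addBits)
      -- These are the codes of the two final zeros; removing them empties the solver's output
      -- stack.
      (pop (Sum.inl tm.k₁) (fun v _ => (v.1, {})) <| pop (Sum.inl tm.k₁) (fun v _ => (v.1, {})) <|
        goto fun _ => .inr .check)
  | .inr .addBits =>
    pop (Sum.inr .sav) (fun v s => (v.1, { v.2 with sym := s })) <|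
    branch (fun v => (lastBit tm v).isSome)
      (pop (Sum.inr .acc) (fun v s => (v.1, { v.2 with dig := s })) <|
        push (Sum.inr .tmp) (fun v => digitOf <|
          digitSum v.2.neg v.2.dig ((lastBit tm v).getD false) v.2.carry) <|
        load (fun v => (v.1, {
          neg := v.2.neg
          carry := carryOf (digitSum v.2.neg v.2.dig ((lastBit tm v).getD false) v.2.carry) })) <|
        goto fun _ => .inr .addBits)
      (goto fun _ => .inr .addRest)
  | .inr .addRest =>
    pop (Sum.inr .acc) (fun v s => (v.1, { v.2 with dig := s })) <|
    branch (fun v => v.2.dig.isSome)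
      (push (Sum.inr .tmp) (fun v => digitOf (digitSum v.2.neg v.2.dig false v.2.carry)) <|
        load (fun v => (v.1, {
          neg := v.2.neg
          carry := carryOf (digitSum v.2.neg v.2.dig false v.2.carry) })) <|
        goto fun _ => .inr .addRest)
      (push (Sum.inr .tmp) (fun v => v.2.carry) <| goto fun _ => .inr .unrev)
  | .inr .unrev =>
    pop (Sum.inr .tmp) (fun v s => (v.1, { dig := s })) <|
    branch (fun v => v.2.dig.isSome)
      (push (Sum.inr .acc) (fun v => v.2.dig.getD 0) <| goto fun _ => .inr .unrev)
      (goto fun _ => .inr .sign)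
  | .inr .check =>
    pop (Sum.inr .acc) (fun v s => (v.1, { v.2 with dig := s })) <|
    branch (fun v => v.2.dig.isSome)
      (load (fun v => (v.1, { flag := v.2.flag && decide (v.2.dig = some 0) })) <|
        goto fun _ => .inr .check)
      -- A proper final configuration has its registers in the initial state.
      (push (Sum.inr .out) (fun v => v.2.flag) <| load (fun v => (v.1, {})) halt)

/-- The combined machine. -/
noncomputable def machine : Turing.FinTM2 where
  K := tm.K ⊕ Tape
  kDecidableEq := inferInstance
  kFin := letI := tm.kFin; inferInstance
  k₀ := .inr .inp
  k₁ := .inr .out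
  Γ := Alphabet tm
  Λ := tm.Λ ⊕ Phase
  main := .inr .count
  ΛFin := letI := tm.ΛFin; inferInstance
  σ := tm.σ × Reg
  initialState := (tm.initialState, {})
  σFin := letI := tm.σFin; inferInstance
  Γk₀Fin := inferInstanceAs (Fintype Symbol)
  m := program e₀ e₁

end Machine

/-! ### Runs that build the padded instance and simulate the solver. -/

section Simulation

open Turing.TM2 (stepAux)
open Turing.TM2.Stmt

variable {tm : Turing.FinTM2}

theorem allStacks_inl (w : ∀ k, List (tm.Γ k)) (T : Tapes) (k : tm.K) :
    allStacks w T (.inl k) = w k := rfl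

theorem allStacks_inr (w : ∀ k, List (tm.Γ k)) (T : Tapes) (k : Tape) :
    allStacks w T (.inr k) = T.get k := rfl

/-- A configuration of the combined machine outside the AMCCR machine. -/
abbrev conf (p : Phase) (r : Reg) (w : ∀ k, List (tm.Γ k)) (T : Tapes) : Conf tm :=
  ⟨some (.inr p), (tm.initialState, r), allStacks w T⟩

/-- Only one stack is nonempty, and it holds the given word. -/
def word {Γ : Type} {k : tm.K} (e : tm.Γ k ≃ Γ) (s : List Γ) : ∀ k, List (tm.Γ k) :=
  Function.update (fun _ => []) k (s.map e.symm)

theorem word_self {Γ : Type} {k : tm.K} (e : tm.Γ k ≃ Γ) (s : List Γ) :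
    word e s k = s.map e.symm := Function.update_self ..

theorem update_word {Γ : Type} {k : tm.K} (e : tm.Γ k ≃ Γ) (s t : List Γ) :
    Function.update (word e s) k (t.map e.symm) = word e t := Function.update_idem ..

variable (e₀ : tm.Γ tm.k₀ ≃ Symbol) (e₁ : tm.Γ tm.k₁ ≃ Bool × Bool)

theorem update_word_cons (s : List Symbol) (a : Symbol) :
    Function.update (word e₀ s) tm.k₀ (e₀.symm a :: List.map e₀.symm s) = word e₀ (a :: s) :=
  update_word e₀ s (a :: s)

theorem stepAux_emit (l s : List Symbol) (q : Code tm) (v : tm.σ × Reg) (T : Tapes) :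
    stepAux (emit e₀ l q) v (allStacks (word e₀ s) T) =
      stepAux q v (allStacks (word e₀ (l ++ s)) T) := by
  induction l generalizing q with
  | nil => rfl
  | cons a l ih =>
    rw [emit, ih, stepAux, update_allStacks_inl, allStacks_inl, word_self, update_word_cons,
      List.cons_append]

theorem runsIn_count (l s : List Symbol) (m : ℕ) (r : Reg) (w : ∀ k, List (tm.Γ k)) :
    RunsIn (Turing.TM2.step (program e₀ e₁)) (l.length + 1)
      (conf .count r w { inp := l, rev := s, cnt := List.replicate m () })
      (conf .back {} w { rev := l.reverse ++ s, cnt := List.replicate (m + l.length) () }) := by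
  induction l generalizing s m r with
  | nil =>
    apply RunsIn.single
    simp [program, allStacks_inr, update_allStacks_inr, Tapes.get, Tapes.set]
  | cons a l ih =>
    have := ih (a :: s) (m + 1) { sym := some a }
    refine RunsIn.head ?_ (by simpa [Nat.add_assoc, Nat.add_comm 1] using this)
    simp [program, allStacks_inr, update_allStacks_inr, Tapes.get, Tapes.set, lastSymbol,
      List.replicate_succ]

theorem runsIn_back (l s : List Symbol) (c : List Unit) (r : Reg) :
    RunsIn (Turing.TM2.step (program e₀ e₁)) (l.length + 1)
      (conf .back r (word e₀ []) { inp := s, rev := l, cnt := c })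
      (conf .loop {} (word e₀ zeros) { inp := l.reverse ++ s, cnt := c }) := by
  induction l generalizing s r with
  | nil =>
    apply RunsIn.single
    simp [program, allStacks_inr, update_allStacks_inr, Tapes.get, Tapes.set, stepAux_emit]
  | cons a l ih =>
    refine RunsIn.head ?_ (by simpa using ih (a :: s) { sym := some a })
    simp [program, allStacks_inr, update_allStacks_inr, Tapes.get, Tapes.set, lastSymbol]

theorem runsIn_padX (m j : ℕ) (s v u : List Symbol) (r : Reg) :
    RunsIn (Turing.TM2.step (program e₀ e₁)) (m + 1)
      (conf .padX r (word e₀ u)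
        { inp := s, sav := v, cnt := List.replicate m (), cnt' := List.replicate j () })
      (conf .bitsX {} (word e₀ (List.replicate m (.bit false) ++ u))
        { inp := s, sav := v, cnt' := List.replicate (m + j) () }) := by
  induction m generalizing j u r with
  | zero =>
    apply RunsIn.single
    simp [program, allStacks_inr, update_allStacks_inr, Tapes.get, Tapes.set]
  | succ m ih =>
    have := ih (j + 1) (.bit false :: u) { more := true }
    refine RunsIn.head ?_ (by
      simpa [Nat.add_assoc, Nat.add_comm 1, List.replicate_succ' (a := Symbol.bit false)]
        using this)
    simp [program, allStacks_inr, update_allStacks_inr, Tapes.get, Tapes.set, stepAux_emit,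
      List.replicate_succ]

theorem runsIn_bitsX (l : List Bool) (s t v u : List Symbol) (c : List Unit) (r : Reg) :
    RunsIn (Turing.TM2.step (program e₀ e₁)) (l.length + 1)
      (conf .bitsX r (word e₀ u)
        { inp := l.map .bit ++ .comma :: s, rev := t, sav := v, cnt' := c })
      (conf .padY { sym := some .comma }
        (word e₀ (leading ++ (List.replicate l.length (.bit false) ++ u)))
        { inp := s, rev := (l.map .bit).reverse ++ t, sav := v, cnt' := c }) := by
  induction l generalizing t u r with
  | nil =>
    apply RunsIn.single
    simp [program, allStacks_inr, update_allStacks_inr, Tapes.get, Tapes.set, lastBit,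
      stepAux_emit]
  | cons a l ih =>
    have := ih (.bit a :: t) (.bit false :: u) { sym := some (.bit a) }
    refine RunsIn.head ?_ (by simpa [List.replicate_succ'] using this)
    simp [program, allStacks_inr, update_allStacks_inr, Tapes.get, Tapes.set, lastBit,
      lastSymbol, stepAux_emit]

theorem runsIn_padY (m j : ℕ) (s t v u : List Symbol) (r : Reg) :
    RunsIn (Turing.TM2.step (program e₀ e₁)) (m + 1)
      (conf .padY r (word e₀ u)
        { inp := s, rev := t, sav := v, cnt := List.replicate j (), cnt' := List.replicate m () })
      (conf .bitsY {} (word e₀ (List.replicate m (.bit false) ++ u))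
        { inp := s, rev := t, sav := .comma :: v, cnt := List.replicate (m + j + 1) () }) := by
  induction m generalizing j u r with
  | zero =>
    apply RunsIn.single
    simp [program, allStacks_inr, update_allStacks_inr, Tapes.get, Tapes.set,
      List.replicate_succ]
  | succ m ih =>
    have := ih (j + 1) (.bit false :: u) { more := true }
    refine RunsIn.head ?_ (by
      simpa [Nat.add_assoc, Nat.add_comm 1, Nat.add_left_comm 1,
        List.replicate_succ' (a := Symbol.bit false)] using this)
    simp [program, allStacks_inr, update_allStacks_inr, Tapes.get, Tapes.set, stepAux_emit,
      List.replicate_succ]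

theorem runsIn_bitsY (l s v u : List Symbol) (m : ℕ) (r : Reg) :
    RunsIn (Turing.TM2.step (program e₀ e₁)) (l.length + 1)
      (conf .bitsY r (word e₀ u)
        { inp := s, rev := l, sav := v, cnt := List.replicate m () })
      (conf .loop {} (word e₀ (l.reverse ++ u))
        { inp := s, sav := l.reverse ++ v, cnt := List.replicate (m + l.length) () }) := by
  induction l generalizing v u m r with
  | nil =>
    apply RunsIn.single
    simp [program, allStacks_inr, update_allStacks_inr, Tapes.get, Tapes.set]
  | cons a l ih =>
    have := ih (a :: v) (a :: u) (m + 1) { sym := some a }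
    refine RunsIn.head ?_ (by simpa [Nat.add_assoc, Nat.add_comm 1] using this)
    simp [program, allStacks_inr, allStacks_inl, update_allStacks_inr, update_allStacks_inl,
      Tapes.get, Tapes.set, lastSymbol, word_self, update_word_cons, List.replicate_succ]

/-- One number of the input is processed. -/
theorem runsIn_loop_cons (l : List Bool) (s v u : List Symbol) (m : ℕ) (r : Reg) :
    RunsIn (Turing.TM2.step (program e₀ e₁)) (2 * (m + l.length) + 5)
      (conf .loop r (word e₀ u)
        { inp := l.map .bit ++ .comma :: s, sav := v, cnt := List.replicate m () })
      (conf .loop {} (word e₀ (pairCode m l ++ u))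
        { inp := s, sav := l.map .bit ++ .comma :: v,
          cnt := List.replicate (m + l.length + 1) () }) := by
  have h₀ : ∃ r', Turing.TM2.step (program e₀ e₁) (conf .loop r (word e₀ u)
      { inp := l.map .bit ++ .comma :: s, sav := v, cnt := List.replicate m () }) =
      some (conf .padX r' (word e₀ (leading ++ u))
      { inp := l.map .bit ++ .comma :: s, sav := v, cnt := List.replicate m () }) := by
    refine ⟨{ sym := (l.map Symbol.bit ++ .comma :: s).head? }, ?_⟩
    cases l <;> simp [program, allStacks_inr, Tapes.get, stepAux_emit]
  obtain ⟨r', h₀⟩ := h₀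
  have h₁ := runsIn_padX e₀ e₁ m 0 (l.map .bit ++ .comma :: s) v (leading ++ u) r'
  have h₂ := runsIn_bitsX e₀ e₁ l s [] v (List.replicate m (.bit false) ++ (leading ++ u))
    (List.replicate m ()) {}
  have h₃ := runsIn_padY e₀ e₁ m 0 s ((l.map .bit).reverse ++ []) v
    (leading ++ (List.replicate l.length (.bit false) ++
      (List.replicate m (.bit false) ++ (leading ++ u)))) { sym := some .comma }
  have h₄ := runsIn_bitsY e₀ e₁ ((l.map .bit).reverse ++ []) s (.comma :: v)
    (List.replicate m (.bit false) ++ (leading ++ (List.replicate l.length (.bit false) ++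
      (List.replicate m (.bit false) ++ (leading ++ u))))) (m + 0 + 1) {}
  have h := (((RunsIn.single h₀).trans h₁).trans h₂).trans (h₃.trans h₄)
  have ht : 1 + (m + 1) + (l.length + 1) +
      (m + 1 + (((l.map Symbol.bit).reverse ++ []).length + 1)) = 2 * (m + l.length) + 5 := by
    simp only [List.append_nil, List.length_reverse, List.length_map]
    ring
  rw [ht] at h
  convert h using 2
  · simp only [pairCode, List.append_nil, List.reverse_reverse, List.append_assoc]
  · simp only [List.append_nil, List.reverse_reverse, List.length_reverse, List.length_map]
    congr 2
    omega

/-- The input is replaced by the code of the padded instance. -/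
theorem runsIn_loop (N : ℕ) (l d : List ℕ) (r : Reg) :
    RunsIn (Turing.TM2.step (program e₀ e₁)) (l.length * (2 * padding N (l.reverse ++ d) + 5) + 1)
      (conf .loop r (word e₀ (paddedCode N d))
        { inp := listCode l, sav := listCode d, cnt := List.replicate (padding N d) () })
      (conf .clear {} (word e₀ (paddedCode N (l.reverse ++ d)))
        { sav := listCode (l.reverse ++ d),
          cnt := List.replicate (padding N (l.reverse ++ d)) () }) := by
  induction l generalizing d r with
  | nil =>
    apply RunsIn.mono (s := 1) (RunsIn.single _) (by omega)
    simp [program, allStacks_inr, Tapes.get, listCode]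
  | cons a l ih =>
    have h₁ := runsIn_loop_cons e₀ e₁ a.bits (listCode l) (listCode d) (paddedCode N d)
      (padding N d) r
    have h₂ := ih (a :: d) {}
    rw [← listCode_cons, ← listCode_cons, Nat.size_eq_bits_len, ← padding_cons] at h₁
    rw [List.reverse_cons, List.append_assoc, List.singleton_append]
    refine (h₁.trans h₂).mono ?_
    have h₃ : padding N (a :: d) ≤ padding N (l.reverse ++ a :: d) := by
      simp only [padding, List.map_append, List.sum_append]
      omega
    rw [padding_cons] at h₃
    rw [List.length_cons, add_mul, one_mul]
    omega

theorem runsIn_clear (m : ℕ) (v : List Symbol) (r : Reg) (w : ∀ k, List (tm.Γ k)) :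
    RunsIn (Turing.TM2.step (program e₀ e₁)) (m + 1)
      (conf .clear r w { sav := v, cnt := List.replicate m () })
      (embedCfg {} { sav := v } ⟨some tm.main, tm.initialState, w⟩) := by
  induction m generalizing r with
  | zero =>
    apply RunsIn.single
    simp [program, allStacks_inr, update_allStacks_inr, Tapes.get, Tapes.set, embedCfg]
  | succ m ih =>
    refine RunsIn.head ?_ (ih { more := true })
    simp [program, allStacks_inr, update_allStacks_inr, Tapes.get, Tapes.set,
      List.replicate_succ]

theorem initList_eq (s : List Symbol) :
    Turing.initList tm (s.map e₀.symm) = ⟨some tm.main, tm.initialState, word e₀ s⟩ := by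
  rw [Turing.initList, word]
  congr 1
  funext k
  by_cases h : k = tm.k₀
  · subst h
    simp
  · simp [h]

theorem haltList_eq (s : List (Bool × Bool)) :
    Turing.haltList tm (s.map e₁.symm) = ⟨none, tm.initialState, word e₁ s⟩ := by
  rw [Turing.haltList, word]
  congr 1
  funext k
  by_cases h : k = tm.k₁
  · subst h
    simp
  · simp [h]

/-- The simulation costs no time: each step of the solver, including the halting one, is one step of
the combined machine. -/
theorem step_embedCfg (r : Reg) (T : Tapes) {c c' : tm.Cfg} (h : tm.step c = some c') :
    Turing.TM2.step (program e₀ e₁) (embedCfg r T c) = some (embedCfg r T c') := by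
  obtain ⟨l, v, S⟩ := c
  cases l with
  | none => exact absurd h (by simp [Turing.FinTM2.step, Turing.TM2.step])
  | some l =>
    have h' : stepAux (tm.m l) v S = c' := Option.some.inj h
    rw [← h', ← stepAux_embed]
    rfl

theorem iterate_bind_none {C : Type*} (f : C → Option C) (n : ℕ) :
    (flip bind f)^[n] none = none := by
  induction n with
  | zero => rfl
  | succ n ih => exact ih

theorem RunsIn.embedCfg (r : Reg) (T : Tapes) {t : ℕ} {c c' : tm.Cfg}
    (h : RunsIn tm.step t c c') :
    RunsIn (Turing.TM2.step (program e₀ e₁)) t (embedCfg r T c) (embedCfg r T c') := by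
  obtain ⟨n, hn, h⟩ := h
  refine ⟨n, hn, ?_⟩
  clear hn
  induction n generalizing c with
  | zero =>
    cases Option.some.inj h
    rfl
  | succ n ih =>
    rw [Function.iterate_succ_apply] at h ⊢
    cases hc : tm.step c with
    | none =>
      have : flip bind tm.step (some c) = none := hc
      rw [this, iterate_bind_none] at h
      cases h
    | some c'' =>
      have h₁ : flip bind tm.step (some c) = some c'' := hc
      have h₂ : flip bind (Turing.TM2.step (program e₀ e₁)) (some (AMCCR.embedCfg r T c)) =
        some (AMCCR.embedCfg r T c'') := step_embedCfg e₀ e₁ r T hc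
      rw [h₂]
      exact ih (h₁ ▸ h)

end Simulation

/-! ### Runs that evaluate the signed sum and test it for zero. -/

section Verification

open Turing.TM2 (stepAux)
open Turing.TM2.Stmt

variable {tm : Turing.FinTM2}
variable (e₀ : tm.Γ tm.k₀ ≃ Symbol) (e₁ : tm.Γ tm.k₁ ≃ Bool × Bool)

theorem runsIn_addRest (l t : List SignType) (s : List Symbol) (r : Reg)
    (w : ∀ k, List (tm.Γ k)) :
    ∃ r', RunsIn (Turing.TM2.step (program e₀ e₁)) (l.length + 1)
      (conf .addRest r w { sav := s, acc := l, tmp := t })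
      (conf .unrev r' w { sav := s, tmp := (addDigits r.neg r.carry [] l).reverse ++ t }) := by
  induction l generalizing t r with
  | nil =>
    refine ⟨{ r with dig := none }, RunsIn.single ?_⟩
    simp [program, allStacks_inr, update_allStacks_inr, Tapes.get, Tapes.set, addDigits]
  | cons d l ih =>
    obtain ⟨r', h⟩ := ih (digitOf (digitSum r.neg (some d) false r.carry) :: t)
      { neg := r.neg, carry := carryOf (digitSum r.neg (some d) false r.carry) }
    refine ⟨r', RunsIn.head ?_ (by simpa [addDigits] using h)⟩
    simp [program, allStacks_inr, update_allStacks_inr, Tapes.get, Tapes.set]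

theorem runsIn_addBits (b : List Bool) (l t : List SignType) (s : List Symbol) (r : Reg)
    (w : ∀ k, List (tm.Γ k)) :
    ∃ r', RunsIn (Turing.TM2.step (program e₀ e₁)) (max b.length l.length + 2)
      (conf .addBits r w { sav := b.map .bit ++ .comma :: s, acc := l, tmp := t })
      (conf .unrev r' w { sav := s, tmp := (addDigits r.neg r.carry b l).reverse ++ t }) := by
  induction b generalizing l t r with
  | nil =>
    obtain ⟨r', h⟩ := runsIn_addRest e₀ e₁ l t s { r with sym := some .comma } w
    refine ⟨r', RunsIn.mono (RunsIn.head ?_ h) (by simp)⟩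
    simp [program, allStacks_inr, update_allStacks_inr, Tapes.get, Tapes.set, lastBit]
  | cons a b ih =>
    obtain ⟨r', h⟩ := ih l.tail (digitOf (digitSum r.neg l.head? a r.carry) :: t)
      { neg := r.neg, carry := carryOf (digitSum r.neg l.head? a r.carry) }
    refine ⟨r', RunsIn.mono (RunsIn.head ?_ (by simpa [addDigits] using h)) (by
      rw [List.length_cons]; omega)⟩
    simp [program, allStacks_inr, update_allStacks_inr, Tapes.get, Tapes.set, lastBit]

theorem runsIn_unrev (t l : List SignType) (s : List Symbol) (r : Reg)
    (w : ∀ k, List (tm.Γ k)) :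
    RunsIn (Turing.TM2.step (program e₀ e₁)) (t.length + 1)
      (conf .unrev r w { sav := s, acc := l, tmp := t })
      (conf .sign {} w { sav := s, acc := t.reverse ++ l }) := by
  induction t generalizing l r with
  | nil =>
    apply RunsIn.single
    simp [program, allStacks_inr, update_allStacks_inr, Tapes.get, Tapes.set]
  | cons d t ih =>
    refine RunsIn.head ?_ (by simpa using ih (d :: l) { dig := some d })
    simp [program, allStacks_inr, update_allStacks_inr, Tapes.get, Tapes.set]

/-- One number is added to the accumulator. -/
theorem runsIn_sign_cons (b : List Bool) (l : List SignType) (s : List Symbol)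
    (y x : Bool × Bool) (cs : List (Bool × Bool)) :
    RunsIn (Turing.TM2.step (program e₀ e₁)) (2 * max b.length l.length + 5)
      (conf .sign {} (word e₁ (y :: x :: cs)) { sav := b.map .bit ++ .comma :: s, acc := l })
      (conf .sign {} (word e₁ cs) { sav := s, acc := addDigits (isNeg y x) 0 b l }) := by
  have h₁ : Turing.TM2.step (program e₀ e₁)
      (conf .sign {} (word e₁ (y :: x :: cs)) { sav := b.map .bit ++ .comma :: s, acc := l }) =
      some (conf .addBits { neg := isNeg y x } (word e₁ cs)
        { sav := b.map .bit ++ .comma :: s, acc := l }) := by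
    have hw := update_word e₁ (y :: x :: cs) (x :: cs)
    have hw' := update_word e₁ (x :: cs) cs
    rw [List.map_cons] at hw
    cases b <;> simp [program, allStacks_inr, allStacks_inl, update_allStacks_inl, Tapes.get,
      word_self, hw, hw']
  obtain ⟨r', h₂⟩ := runsIn_addBits e₀ e₁ b l [] s { neg := isNeg y x } (word e₁ cs)
  have h₃ := runsIn_unrev e₀ e₁ ((addDigits (isNeg y x) 0 b l).reverse ++ []) [] s r' (word e₁ cs)
  have h := (RunsIn.single h₁).trans (h₂.trans h₃)
  simp only [List.append_nil, List.reverse_reverse, List.length_reverse, length_addDigits] at h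
  exact h.mono (by omega)

/-- The accumulator receives the signed sum. -/
theorem runsIn_sign (l : List ℕ) (cs : List (Bool × Bool)) (hcs : cs.length = 2 * l.length + 2)
    (acc : List SignType) :
    ∃ acc', digitsValue acc' = digitsValue acc + signedSum l cs ∧
      acc'.length ≤ acc.length + padding 0 l ∧
      RunsIn (Turing.TM2.step (program e₀ e₁))
        (l.length * (2 * (acc.length + padding 0 l) + 5) + 1)
        (conf .sign {} (word e₁ cs) { sav := listCode l, acc := acc })
        (conf .check {} (word e₁ []) { acc := acc' }) := by
  induction l generalizing cs acc with
  | nil =>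
    refine ⟨acc, by simp [signedSum], by simp, RunsIn.mono (s := 1) (RunsIn.single ?_) (by omega)⟩
    obtain ⟨y, x, rfl⟩ := List.length_eq_two.1 hcs
    have hw := update_word e₁ [y, x] [x]
    have hw' := update_word e₁ [x] []
    simp only [List.map_cons, List.map_nil] at hw hw'
    simp [program, allStacks_inr, allStacks_inl, update_allStacks_inl, Tapes.get, word_self,
      listCode, hw, hw']
  | cons a l ih =>
    match cs, hcs with
    | y :: x :: cs, hcs =>
      have h₁ := runsIn_sign_cons e₀ e₁ a.bits acc (listCode l) y x cs
      rw [← listCode_cons, Nat.size_eq_bits_len] at h₁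
      obtain ⟨acc', hv, hl, h₂⟩ := ih cs (by simp only [List.length_cons] at hcs; omega)
        (addDigits (isNeg y x) 0 a.bits acc)
      rw [digitsValue_addDigits] at hv
      rw [length_addDigits, Nat.size_eq_bits_len] at hl h₂
      refine ⟨acc', ?_, ?_, (h₁.trans h₂).mono ?_⟩
      · rw [hv, signedSum, SignType.coe_zero, add_zero, add_assoc]
      · rw [padding_cons]
        omega
      · have h₃ : l.length * (2 * (max a.size acc.length + 1 + padding 0 l) + 5) ≤
            l.length * (2 * (acc.length + padding 0 (a :: l)) + 5) :=
          Nat.mul_le_mul_left _ (by rw [padding_cons]; omega)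
        have h₄ : max a.size acc.length ≤ acc.length + padding 0 (a :: l) := by
          rw [padding_cons]; omega
        rw [List.length_cons, add_mul, one_mul]
        omega

theorem runsIn_check (l : List SignType) (f : Bool) (r : Reg) (hr : r.flag = f)
    (w : ∀ k, List (tm.Γ k)) :
    RunsIn (Turing.TM2.step (program e₀ e₁)) (l.length + 1)
      (conf .check r w { acc := l })
      ⟨none, (tm.initialState, {}),
        allStacks w { out := [f && l.all fun d => decide (d = 0)] }⟩ := by
  induction l generalizing f r with
  | nil =>
    apply RunsIn.single
    simp [program, allStacks_inr, update_allStacks_inr, Tapes.get, Tapes.set, hr]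
  | cons d l ih =>
    have := ih (f && decide (d = 0)) { flag := f && decide (d = 0) } rfl
    rw [Bool.and_assoc] at this
    refine RunsIn.head ?_ this
    simp [program, allStacks_inr, update_allStacks_inr, Tapes.get, Tapes.set, hr]

theorem initList_machine (s : List Symbol) :
    Turing.initList (machine e₀ e₁) s = conf .count {} (word e₀ []) { inp := s } := by
  refine congrArg (Turing.TM2.Cfg.mk _ _) (funext fun k => ?_)
  rcases k with k | k
  · simp [machine, allStacks, word]
  · cases k <;> rfl

theorem haltList_machine (s : List Bool) :
    Turing.haltList (machine e₀ e₁) s =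
      ⟨none, (tm.initialState, {}), allStacks (word e₁ []) { out := s }⟩ := by
  refine congrArg (Turing.TM2.Cfg.mk _ _) (funext fun k => ?_)
  rcases k with k | k
  · simp [machine, allStacks, word]
  · cases k <;> rfl

end Verification

/-! ### The polynomial-time reduction. -/

section Reduction

/-- Coefficients are natural numbers. Needed since the length of the padded instance is only bounded
from above. -/
theorem eval_mono (p : Polynomial ℕ) {m n : ℕ} (h : m ≤ n) : p.eval m ≤ p.eval n := by
  rw [Polynomial.eval_eq_sum_range, Polynomial.eval_eq_sum_range]
  gcongr

/-- The reduction of PARTITION to AMCCR. -/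
noncomputable def decidePartition (alg : Instance → List (Bool × Bool)) (A : PartitionInstance) :
    Bool :=
  decide (signedSum A.reversed (alg (paddedInstance A.encode.length A.reversed)) = 0)

/-- The running time of the combined machine. -/
noncomputable def totalTime (p : Polynomial ℕ) : Polynomial ℕ :=
  p.comp (Polynomial.X * (4 * Polynomial.X + 8) + 6) +
    (Polynomial.X * (6 * Polynomial.X + 10) + (5 * Polynomial.X + 6))

theorem eval_totalTime (p : Polynomial ℕ) (n : ℕ) :
    (totalTime p).eval n = p.eval (n * (4 * n + 8) + 6) + (n * (6 * n + 10) + (5 * n + 6)) := by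
  simp [totalTime]

theorem runsIn_machine {alg : Instance → List (Bool × Bool)}
    (h : Turing.TM2ComputableInPolyTime Instance.encode id alg)
    (halg : ∀ I : Instance, (alg I).length = I.k) (A : PartitionInstance) :
    RunsIn (machine h.inputAlphabet h.outputAlphabet).step ((totalTime h.time).eval A.encode.length)
      (Turing.initList (machine h.inputAlphabet h.outputAlphabet) A.encode)
      (Turing.haltList (machine h.inputAlphabet h.outputAlphabet) [decidePartition alg A]) := by
  set e₀ := h.inputAlphabet
  set e₁ := h.outputAlphabet
  set n := A.encode.length with hn
  have hn' : n = padding 0 A.reversed := by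
    rw [hn, A.encode_eq, length_listCode, PartitionInstance.reversed, padding_reverse]
  -- The counter starts at the input length n and gains one unit for each of the n symbols.
  have hpad : padding n A.reversed = 2 * n := by
    have : padding n A.reversed = n + padding 0 A.reversed := by simp [padding]
    omega
  have hlen : A.reversed.length ≤ n := hn' ▸ length_le_padding 0 A.reversed
  have hI := encode_paddedInstance n A.reversed
  have hIlen : (paddedInstance n A.reversed).encode.length ≤ n * (4 * n + 8) + 6 := by
    have h₁ := length_paddedCode_le n A.reversed
    have h₂ : A.reversed.length * (2 * padding n A.reversed + 8) ≤ n * (4 * n + 8) :=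
      Nat.mul_le_mul hlen (by omega)
    rw [hI]
    omega
  have h₁ := runsIn_count e₀ e₁ A.encode [] 0 {} (word e₀ [])
  rw [List.append_nil, zero_add, ← hn] at h₁
  have h₂ := runsIn_back e₀ e₁ A.encode.reverse [] (List.replicate n ()) {}
  rw [List.append_nil, List.reverse_reverse, List.length_reverse, ← hn] at h₂
  have h₃ := runsIn_loop e₀ e₁ n (List.ofFn fun i => (A.a i : ℕ)) [] {}
  rw [List.append_nil, ← A.encode_eq] at h₃
  change RunsIn _ _ _ (conf _ _ (word e₀ (paddedCode n A.reversed))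
    { sav := listCode A.reversed, cnt := List.replicate (padding n A.reversed) () }) at h₃
  have h₄ := runsIn_clear e₀ e₁ (padding n A.reversed) (listCode A.reversed) {}
    (word e₀ (paddedCode n A.reversed))
  have h₅ : RunsIn h.tm.step (h.time.eval (paddedInstance n A.reversed).encode.length)
      ⟨some h.tm.main, h.tm.initialState, word e₀ (paddedCode n A.reversed)⟩
      ⟨none, h.tm.initialState, word e₁ (alg (paddedInstance n A.reversed))⟩ := by
    have ho := h.outputsFun (paddedInstance n A.reversed)
    rw [← initList_eq, ← haltList_eq, ← hI]
    exact ⟨ho.steps, ho.steps_le_m, ho.evals_in_steps⟩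
  have h₅' := h₅.embedCfg e₀ e₁ {} { sav := listCode A.reversed }
  obtain ⟨acc, hv, hl, h₆⟩ := runsIn_sign e₀ e₁ A.reversed (alg (paddedInstance n A.reversed))
    (by rw [halg]; exact length_padded _ _) []
  have h₇ := runsIn_check e₀ e₁ acc true {} rfl (word e₁ [])
  have hflag : (true && acc.all fun d => decide (d = 0)) = decidePartition alg A := by
    rw [Bool.true_and, Bool.eq_iff_iff, ← digitsValue_eq_zero_iff, hv, decidePartition,
      decide_eq_true_iff, ← hn]
    simp [digitsValue]
  rw [hflag] at h₇
  refine RunsIn.congr (RunsIn.mono (h₁.trans (h₂.trans (h₃.trans (h₄.trans (h₅'.trans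
    (h₆.trans h₇)))))) ?_) (initList_machine e₀ e₁ _) (haltList_machine e₀ e₁ _)
  have hm₁ := eval_mono h.time hIlen
  have hm₂ : (List.ofFn fun i => (A.a i : ℕ)).length * (2 * padding n A.reversed + 5) ≤
      n * (4 * n + 5) :=
    Nat.mul_le_mul (by rwa [PartitionInstance.reversed, List.length_reverse] at hlen) (by omega)
  have hm₃ : A.reversed.length *
      (2 * (List.length ([] : List SignType) + padding 0 A.reversed) + 5) ≤ n * (2 * n + 5) :=
    Nat.mul_le_mul hlen (by simp [← hn'])
  have hm₄ : acc.length ≤ n := by simpa [← hn'] using hl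
  have hm₅ : n * (6 * n + 10) = n * (4 * n + 5) + n * (2 * n + 5) := by ring
  rw [eval_totalTime]
  simp only [PartitionInstance.reversed] at *
  omega

theorem partitionPolyTimeDecidable (hsolv : PolyTimeSolvable) : PartitionPolyTimeDecidable := by
  obtain ⟨alg, ⟨h⟩, halg⟩ := hsolv
  -- The evaluation pops two codes for each number and two at the end, so the answer must have
  -- exactly this length.
  have hlen : ∀ I : Instance, (alg I).length = I.k := fun I => by
    obtain ⟨Jp, Jm, h, -⟩ := halg I
    rw [h, encodePair, List.length_ofFn]
  refine ⟨decidePartition alg, ⟨{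
    tm := machine h.inputAlphabet h.outputAlphabet
    inputAlphabet := Equiv.refl Symbol
    outputAlphabet := Equiv.refl Bool
    time := totalTime h.time
    outputsFun := fun A => ?_ }⟩, fun A => ?_⟩
  · have hr := runsIn_machine h hlen A
    refine ⟨⟨hr.choose, ?_⟩, hr.choose_spec.1⟩
    convert hr.choose_spec.2 using 3
    · exact congrArg _ (List.map_id _)
    · rfl
  · obtain ⟨Jp, Jm, hJ, hs⟩ := halg (paddedInstance A.encode.length A.reversed)
    rw [decidePartition, decide_eq_true_iff, hJ]
    refine signedSum_eq_zero_iff A _ ?_ hs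
    rw [A.encode_eq, length_listCode, PartitionInstance.reversed, padding_reverse]

end Reduction

end AMCCR

theorem mainTheorem1 :
    (∀ (A : AMCCR.PartitionInstance) (ξ : Fin A.k → ℝ),
      AMCCR.IsMaximizer (fun i => ((A.a i : ℕ) : ℝ)) ξ →
        ((∀ i, AMCCR.Filled (fun i => ((A.a i : ℕ) : ℝ)) ξ i) ↔ A.IsPositive)) ∧
    (AMCCR.PolyTimeSolvable → AMCCR.PartitionPolyTimeDecidable) :=
  ⟨AMCCR.filled_iff_isPositive, AMCCR.partitionPolyTimeDecidable⟩
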